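/- Let $k$ be a field and $\Lambda=k[p]$ the polynomial algebra in one variable. A partition $\alpha=(\alpha_1\ge\dots\ge\alpha_n)$ is identified with the Young diagram having columns of lengths $\alpha_1,\dots,\alpha_n$ (top-aligned), $\overline{\alpha}$ is the transposed partition, and $N_\alpha=\bigoplus_i\Lambda/(p^{\alpha_i})$. Let $\mathcal S(\Lambda)$ be the category of embeddings $(A\subset B)$, where $B$ is a finite-dimensional $\Lambda$-module on which $p$ acts nilpotently and $A$ is a submodule; morphisms $(A\subset B)\to(A'\subset B')$ are the $\Lambda$-homomorphisms $B\to B'$ mapping $A$ into $A'$, and a sequence $0\to U\to H\to V\to 0$ in $\mathcal S(\Lambda)$ is exact if it is exact on the modules $B$ and on the submodules $A$. Let $\gamma\subseteq\beta$ be partitions. An LR-tableau of shape $\beta\setminus\gamma$ is a filling of the cells of $\beta\setminus\gamma$ with positive integers that is weakly increasing along rows, strictly increasing down columns, and such that for all $e\ge1$ and every column $c$ the columns from $c$ on to the right contain at least as many entries $e$ as entries $e+1$. It is identified with the sequence $\gamma=\gamma^{(0)}\subseteq\gamma^{(1)}\subseteq\dots\subseteq\beta$, eventually equal to $\beta$,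 where $\gamma^{(e)}$ consists of $\gamma$ and all cells with entry at most $e$. An embedding $X=(A\subset B)$ has LR-tableau $LR(X)=[\gamma^{(0)},\gamma^{(1)},\dots]$ if $B/p^eA\cong N_{\gamma^{(e)}}$ for all $e\ge0$. The skew diagram $\beta\setminus\gamma$ is a rook strip if $\beta_i\le\gamma_i+1$ and $\overline{\beta}_i\le\overline{\gamma}_i+1$ for all $i$, i.e. if it has at most one cell in each column and in each row. For embeddings $X,Y$ write $X\le_{\sf ext}Y$ if there are embeddings $H_1,\dots,H_{s+1}$ with $X\cong H_1$, $Y\cong H_{s+1}$, and short exact sequences $0\to U_i\to H_i\to V_i\to0$ in $\mathcal S(\Lambda)$ with $U_i\oplus V_i\cong H_{i+1}$ for $1\le i\le s$. For LR-tableaux $\Gamma,\widetilde\Gamma$ of shape $\beta\setminus\gamma$ write $\Gamma\le_{\sf ext}\widetilde\Gamma$ if there is a sequence $\Gamma=\Gamma^{(0)},\dots,\Gamma^{(s)}=\widetilde\Gamma$ of LR-tableaux of shape $\beta\setminus\gamma$ such that for each $1\le i\le s$ there are embeddings $X=(A\subset B)$, $Y=(A'\subset B')$ with $B\cong B'\cong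 N_\beta$, $B/A\cong B'/A'\cong N_\gamma$, $LR(X)=\Gamma^{(i-1)}$, $LR(Y)=\Gamma^{(i)}$ and $X\le_{\sf ext}Y$. **Proposition.** Let $\beta\setminus\gamma$ be a rook strip and let $\Delta,\Gamma$ be LR-tableaux of shape $\beta\setminus\gamma$ such that $\Delta$ is obtained from $\Gamma$ by increasing one entry. Then $\Delta\le_{\sf ext}\Gamma$. -/

import Mathlib

open Polynomial

universe u

namespace RookStrip

/-! ### Skew diagrams and Littlewood–Richardson tableaux

Partitions are Young diagrams.  The parts of the partition `α` are the lengths of the *columns*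
of its diagram, i.e. `α_{j+1} = α.colLen j`.  A cell is `(row, column)`, rows are numbered from
top to bottom and columns from left to right, both starting with `0`. -/

/-- The skew diagram `β \ γ` is a rook strip: it has at most one cell in each column
(`β_j ≤ γ_j + 1`) and at most one cell in each row (the same for the transposed partitions). -/
def IsRookStrip (β γ : YoungDiagram) : Prop :=
  γ ≤ β ∧ (∀ j, β.colLen j ≤ γ.colLen j + 1) ∧ (∀ i, β.rowLen i ≤ γ.rowLen i + 1)

/-- Littlewood–Richardson tableaux of shape `β \ γ` (and of arbitrary content).
The function `entry` gives the (positive) entries on `β \ γ` and is set to be `0` elsewhere.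
In the field `lattice`, the case `c = 0` says that the number of entries `e` is weakly decreasing
in `e ≥ 1`, i.e. that the content of the tableau is a partition. -/
@[ext]
structure LRTableau (β γ : YoungDiagram) where
  le : γ ≤ β
  entry : ℕ → ℕ → ℕ
  pos : ∀ i j, (i, j) ∈ β → (i, j) ∉ γ → 1 ≤ entry i j
  zero : ∀ i j, ((i, j) ∉ β ∨ (i, j) ∈ γ) → entry i j = 0
  row_weak : ∀ i j₁ j₂, j₁ < j₂ → (i, j₁) ∉ γ → (i, j₂) ∈ β → entry i j₁ ≤ entry i j₂
  col_strict : ∀ i₁ i₂ j, i₁ < i₂ → (i₁, j) ∉ γ → (i₂, j) ∈ β → entry i₁ j < entry i₂ j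
  lattice : ∀ c e, 1 ≤ e →
    (β.cells.filter fun x => c ≤ x.2 ∧ entry x.1 x.2 = e + 1).card ≤
      (β.cells.filter fun x => c ≤ x.2 ∧ entry x.1 x.2 = e).card

theorem LRTableau.entry_mono {β γ : YoungDiagram} (Γ : LRTableau β γ) {i₁ i₂ j₁ j₂ : ℕ}
    (hi : i₁ ≤ i₂) (hj : j₁ ≤ j₂) (h : (i₂, j₂) ∈ β) : Γ.entry i₁ j₁ ≤ Γ.entry i₂ j₂ := by
  by_cases h1 : (i₁, j₁) ∈ γ
  · simp [Γ.zero i₁ j₁ (Or.inr h1)]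
  have h2 : (i₁, j₂) ∈ β := β.up_left_mem hi le_rfl h
  have h3 : (i₁, j₂) ∉ γ := fun hc => h1 (γ.up_left_mem le_rfl hj hc)
  calc Γ.entry i₁ j₁ ≤ Γ.entry i₁ j₂ := by
        rcases hj.eq_or_lt with rfl | hlt
        · exact le_rfl
        · exact Γ.row_weak i₁ j₁ j₂ hlt h1 h2
    _ ≤ Γ.entry i₂ j₂ := by
        rcases hi.eq_or_lt with rfl | hlt
        · exact le_rfl
        · exact (Γ.col_strict i₁ i₂ j₂ hlt h3 h).le

/-- The partition `γ^(e)`: the diagram formed by `γ` and all cells with entry at most `e`.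
The tableau `Γ` is identified with the sequence `γ = γ^(0) ⊆ γ^(1) ⊆ … ⊆ β`, which is
eventually constant with value `β`. -/
def LRTableau.stage {β γ : YoungDiagram} (Γ : LRTableau β γ) (e : ℕ) : YoungDiagram where
  cells := β.cells.filter fun x => Γ.entry x.1 x.2 ≤ e
  isLowerSet := by
    rintro ⟨i₂, j₂⟩ ⟨i₁, j₁⟩ ⟨hi, hj⟩ h
    simp only [Finset.coe_filter, Set.mem_ofPred_eq, YoungDiagram.mem_cells] at h ⊢
    exact ⟨β.up_left_mem hi hj h.1, (Γ.entry_mono hi hj h.1).trans h.2⟩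

/-- `Δ` is obtained from `Γ` by increasing one entry. -/
def LRTableau.IncreasesEntry {β γ : YoungDiagram} (Δ Γ : LRTableau β γ) : Prop :=
  ∃ i j, (i, j) ∈ β ∧ (i, j) ∉ γ ∧ Γ.entry i j < Δ.entry i j ∧
    ∀ i' j', (i', j') ≠ (i, j) → Δ.entry i' j' = Γ.entry i' j'

/-! ### Invariant subspaces of nilpotent linear operators

The variable `p` of the polynomial algebra `Λ = k[p]` is `Polynomial.X`. -/

/-- `N_α = ⨁_j Λ/(p^{α_j})`, the sum taken over the columns of the diagram `α`. -/
abbrev N (k : Type u) [Field k] (α : YoungDiagram) : Type u :=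
  (j : Fin (α.rowLen 0)) → k[X] ⧸ Ideal.span {(X : k[X]) ^ α.colLen j}

/-- The objects `(A ⊂ B)` of `S(Λ)`: `B` is a finitely generated `Λ`-module on which `p` acts
nilpotently (equivalently, a nilpotent linear operator on a finite dimensional `k`-space), and
`A` is a submodule of `B`. -/
structure Emb (k : Type u) [Field k] : Type (u + 1) where
  B : Type u
  [addCommGroup : AddCommGroup B]
  [module : Module k[X] B]
  [finite : Module.Finite k[X] B]
  nilpotent : ∃ n : ℕ, ∀ b : B, (X : k[X]) ^ n • b = 0
  A : Submodule k[X] B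

attribute [instance] Emb.addCommGroup Emb.module Emb.finite

namespace Emb

variable {k : Type u} [Field k]

/-- Morphisms `(A ⊂ B) → (A' ⊂ B')`: `Λ`-linear maps `B → B'` carrying `A` into `A'`. -/
structure Hom (U V : Emb k) where
  toLin : U.B →ₗ[k[X]] V.B
  maps : ∀ a ∈ U.A, toLin a ∈ V.A

/-- The map `A → A'` induced by a morphism `(A ⊂ B) → (A' ⊂ B')`. -/
noncomputable def Hom.sub {U V : Emb k} (f : Hom U V) : U.A →ₗ[k[X]] V.A :=
  f.toLin.restrict f.maps

/-- The sequence `0 → U → H → V → 0` is exact in `S(Λ)`: both the sequence of the modules `B`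
and the sequence of the submodules `A` are exact. -/
def IsShortExact {U H V : Emb k} (f : Hom U H) (g : Hom H V) : Prop :=
  (Function.Injective f.toLin ∧ Function.Exact f.toLin g.toLin ∧ Function.Surjective g.toLin) ∧
  (Function.Injective f.sub ∧ Function.Exact f.sub g.sub ∧ Function.Surjective g.sub)

/-- Isomorphism of objects of `S(Λ)`. -/
def IsIso (U V : Emb k) : Prop :=
  ∃ φ : U.B ≃ₗ[k[X]] V.B, ∀ b, b ∈ U.A ↔ φ b ∈ V.A

/-- The direct sum of two objects of `S(Λ)`. -/
noncomputable def directSum (U V : Emb k) : Emb k where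
  B := U.B × V.B
  nilpotent := by
    obtain ⟨m, hm⟩ := U.nilpotent
    obtain ⟨n, hn⟩ := V.nilpotent
    refine ⟨m + n, fun b => Prod.ext ?_ ?_⟩
    · rw [Prod.smul_fst, add_comm, pow_add, mul_smul, hm, smul_zero, Prod.fst_zero]
    · rw [Prod.smul_snd, pow_add, mul_smul, hn, smul_zero, Prod.snd_zero]
  A := U.A.prod V.A

/-- The relation `U ≤_ext V` between objects of `S(Λ)`: there are objects `H_0, …, H_s` with
`U ≅ H_0`, `V ≅ H_s`, and for all `i < s` a short exact sequence `0 → U_i → H_i → V_i → 0` with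
`U_i ⊕ V_i ≅ H_{i+1}`. -/
def ExtLE (U V : Emb k) : Prop :=
  ∃ (s : ℕ) (H : ℕ → Emb k), IsIso U (H 0) ∧ IsIso V (H s) ∧
    ∀ i < s, ∃ (U' V' : Emb k) (f : Hom U' (H i)) (g : Hom (H i) V'),
      IsShortExact f g ∧ IsIso (directSum U' V') (H (i + 1))

/-- The submodule `p^e A` of `B`. -/
noncomputable def powA (U : Emb k) (e : ℕ) : Submodule k[X] U.B :=
  U.A.map (LinearMap.lsmul k[X] U.B ((X : k[X]) ^ e))

/-- `(A ⊂ B)` belongs to `S_{r,γ}^β`, where `r = |β| - |γ|`: `B ≅ N_β` and `B/A ≅ N_γ`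
(then `A` has dimension `r`). -/
def HasType (U : Emb k) (β γ : YoungDiagram) : Prop :=
  Nonempty (U.B ≃ₗ[k[X]] N k β) ∧ Nonempty ((U.B ⧸ U.A) ≃ₗ[k[X]] N k γ)

/-- `LR(A ⊂ B) = Γ`: the partition `γ^(e)` of `Γ` is the isomorphism type of `B/p^e A`,
for all `e`. -/
def HasTableau (U : Emb k) {β γ : YoungDiagram} (Γ : LRTableau β γ) : Prop :=
  ∀ e : ℕ, Nonempty ((U.B ⧸ U.powA e) ≃ₗ[k[X]] N k (Γ.stage e))

end Emb

/-- The relation `Γ ≤_ext Γ'` on the Littlewood–Richardson tableaux of shape `β \ γ`, with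
respect to the field `k`: there is a sequence `Γ = Γ^(0), …, Γ^(s) = Γ'` of tableaux such that
for all `i < s` there are `U, V` in `S_{r,γ}^β` with tableaux `Γ^(i)` and `Γ^(i+1)`,
respectively, and `U ≤_ext V`. -/
def LRTableau.ExtLE (k : Type u) [Field k] {β γ : YoungDiagram} (Γ Γ' : LRTableau β γ) : Prop :=
  ∃ (s : ℕ) (G : ℕ → LRTableau β γ), G 0 = Γ ∧ G s = Γ' ∧
    ∀ i < s, ∃ U V : Emb k, U.HasType β γ ∧ V.HasType β γ ∧
      U.HasTableau (G i) ∧ V.HasTableau (G (i + 1)) ∧ Emb.ExtLE U V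

end RookStrip

/-! On a rook strip every column carries at most one entry, and columns with entries have distinct
lengths. By the lattice condition and Hall's theorem, each entry `e + 1` can be matched injectively
with an entry `e` in a shorter column, so the filled columns fall into strings with entries 1, 2, 3,
and so on. A string defines a generator with component `X ^ (b i - n)` in the column `i` at place
`n`. For the submodule `A` spanned by these generators, passing to `B / X ^ e A` shortens by one
exactly the columns whose largest place exceeds `e` (`StringSystem.nonempty_quotient_equiv`). Hence
the tableau records the largest place of each column.

Let column `m` carry `p` in `Γ` and `q > p` in `Δ`. Mixing the matchings of the two tableaux yields
one decomposition of the other columns, with distinct strings `S` and `T` that `m` can extend at the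
places `p` and `q` (`exists_strings`). Attaching `m` to `S` alone realizes `Γ`; attaching it to both
realizes `Δ`, since only the larger place counts. In the second object let `W` be the sum of `m` and
the columns of `S`. Then `A ∩ W` is generated by the generator of `S`, and modulo `W` the generator
of `T` loses its component at `m`. So subobject plus factor object is the first object
(`Strings.extLE_attach`), and one exact sequence suffices. -/

namespace RookStrip

/-! ### Quotients of sums of truncated polynomial rings -/

section Trunc

variable (k : Type u) [Field k]

/-- The indecomposable `k[X]`-module `k[X]/(X^n)`. -/
abbrev Trunc (n : ℕ) : Type u := k[X] ⧸ Ideal.span {(X : k[X]) ^ n}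

variable {k}

/-- The class of a polynomial in `k[X]/(X^n)`. -/
noncomputable def Trunc.mk (n : ℕ) : k[X] →ₗ[k[X]] Trunc k n := Submodule.mkQ _

theorem Trunc.mk_surjective (n : ℕ) : Function.Surjective (Trunc.mk (k := k) n) :=
  Submodule.mkQ_surjective _

theorem Trunc.mk_eq_zero {n : ℕ} {f : k[X]} : Trunc.mk n f = 0 ↔ (X : k[X]) ^ n ∣ f := by
  rw [← Ideal.mem_span_singleton]
  exact Submodule.Quotient.mk_eq_zero _

/-- Multiplication by `f` as a map `k[X]/(X^m) → k[X]/(X^n)`. -/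
noncomputable def Trunc.mul (f : k[X]) {m n : ℕ} (h : (X : k[X]) ^ n ∣ f * X ^ m) :
    Trunc k m →ₗ[k[X]] Trunc k n :=
  Submodule.liftQ _ ((Trunc.mk n).comp (LinearMap.mulLeft k[X] f)) <| by
    rw [Ideal.span, Submodule.span_le, Set.singleton_subset_iff]
    exact Trunc.mk_eq_zero.2 h

@[simp]
theorem Trunc.mul_mk (f g : k[X]) {m n : ℕ} (h : (X : k[X]) ^ n ∣ f * X ^ m) :
    Trunc.mul f h (Trunc.mk m g) = Trunc.mk n (f * g) :=
  rfl

variable {κ : Type*} [Fintype κ]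

/-- The map between sums of truncated polynomial rings given by the matrix `1 - C`. -/
noncomputable def oneSub (b d : κ → ℕ) (C : κ → κ → k[X]) (hd : ∀ i, d i ≤ b i)
    (hC : ∀ i j, (X : k[X]) ^ d i ∣ C i j * X ^ b j) :
    ((i : κ) → Trunc k (b i)) →ₗ[k[X]] ((i : κ) → Trunc k (d i)) :=
  LinearMap.pi fun i =>
    (Trunc.mul 1 (by rw [one_mul]; exact pow_dvd_pow _ (hd i))).comp (LinearMap.proj i) -
      ∑ j, (Trunc.mul (C i j) (hC i j)).comp (LinearMap.proj j)

theorem oneSub_mk {b d : κ → ℕ} {C : κ → κ → k[X]} (hd : ∀ i, d i ≤ b i)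
    (hC : ∀ i j, (X : k[X]) ^ d i ∣ C i j * X ^ b j) (f : κ → k[X]) (i : κ) :
    oneSub b d C hd hC (fun i => Trunc.mk (b i) (f i)) i =
      Trunc.mk (d i) (f i - ∑ j, C i j * f j) := by
  simp [oneSub, LinearMap.sum_apply]

theorem oneSub_apply {b d : κ → ℕ} {C : κ → κ → k[X]} (hd : ∀ i, d i ≤ b i)
    (hC : ∀ i j, (X : k[X]) ^ d i ∣ C i j * X ^ b j) (y : (i : κ) → Trunc k (b i)) (i : κ)
    (hy : ∀ j, C i j ≠ 0 → y j = 0) :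
    oneSub b d C hd hC y i =
      Trunc.mul 1 (by rw [one_mul]; exact pow_dvd_pow _ (hd i)) (y i) := by
  simp only [oneSub, LinearMap.pi_apply, LinearMap.sub_apply, LinearMap.sum_apply,
    LinearMap.comp_apply, LinearMap.proj_apply]
  rw [Finset.sum_eq_zero, sub_zero]
  intro j _
  by_cases hj : C i j = 0
  · obtain ⟨f, hf⟩ := Trunc.mk_surjective _ (y j)
    rw [← hf, Trunc.mul_mk, hj, zero_mul, map_zero]
  · rw [hy j hj, map_zero]

/-- `C` is strictly triangular for the level `r`: correcting a preimage at level `n` leaves the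
values below `n` unchanged and acts on those at `n` only through the diagonal. -/
theorem oneSub_surjective {b d : κ → ℕ} {C : κ → κ → k[X]} (hd : ∀ i, d i ≤ b i)
    (hC : ∀ i j, (X : k[X]) ^ d i ∣ C i j * X ^ b j) (r : κ → ℕ)
    (hr : ∀ i j, C i j ≠ 0 → r j < r i) :
    Function.Surjective (oneSub b d C hd hC) := by
  intro z
  have key : ∀ n, ∃ y, ∀ i, r i < n → oneSub b d C hd hC y i = z i := by
    intro n
    induction n with
    | zero => exact ⟨0, fun i hi => absurd hi (Nat.not_lt_zero _)⟩
    | succ n ih =>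
      obtain ⟨y, hy⟩ := ih
      choose f hf using fun i => Trunc.mk_surjective _ (z i - oneSub b d C hd hC y i)
      refine ⟨y + fun i => if r i = n then Trunc.mk (b i) (f i) else 0, fun i hi => ?_⟩
      rw [map_add, Pi.add_apply, oneSub_apply hd hC (fun i => if r i = n then _ else _)]
      · rcases Nat.lt_succ_iff_lt_or_eq.1 hi with h | h
        · rw [if_neg h.ne, map_zero, add_zero, hy i h]
        · rw [if_pos h, Trunc.mul_mk, one_mul, hf, add_sub_cancel]
      · intro j hj
        exact if_neg (by have := hr i j hj; omega)
  obtain ⟨y, hy⟩ := key (Finset.univ.sup r + 1)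
  exact ⟨y, funext fun i => hy i (Nat.lt_succ_of_le (Finset.le_sup (Finset.mem_univ i)))⟩

/-- If a kernel element vanishes below level `n`, triangularity makes its coordinates at level `n`
multiples of `X ^ d i`. Subtracting these multiples of the elements `h i` pushes it to level `n +
1`. -/
theorem ker_oneSub_le {b d : κ → ℕ} {C : κ → κ → k[X]} (hd : ∀ i, d i ≤ b i)
    (hC : ∀ i j, (X : k[X]) ^ d i ∣ C i j * X ^ b j) (r : κ → ℕ)
    (hr : ∀ i j, C i j ≠ 0 → r j < r i) (M : Submodule k[X] ((i : κ) → Trunc k (b i)))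
    (hle : M ≤ LinearMap.ker (oneSub b d C hd hC))
    (hM : ∀ i, ∃ h ∈ M, h i = Trunc.mk (b i) (X ^ d i) ∧ ∀ j, r j ≤ r i → j ≠ i → h j = 0) :
    LinearMap.ker (oneSub b d C hd hC) ≤ M := by
  choose h hmem hself hother using hM
  have key : ∀ s n, Finset.univ.sup r < n + s →
      ∀ y ∈ LinearMap.ker (oneSub b d C hd hC), (∀ i, r i < n → y i = 0) → y ∈ M := by
    intro s
    induction s with
    | zero =>
      intro n hn y _ hy
      have : y = 0 := funext fun i => hy i ((Finset.le_sup (Finset.mem_univ i)).trans_lt hn)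
      exact this ▸ M.zero_mem
    | succ s ih =>
      intro n hn y hyk hy
      have hu : ∀ i, ∃ u : k[X], r i = n → y i = u • Trunc.mk (b i) (X ^ d i) := by
        intro i
        by_cases hi : r i = n
        swap
        · exact ⟨0, fun h => absurd h hi⟩
        obtain ⟨f, hf⟩ := Trunc.mk_surjective _ (y i)
        have h0 : oneSub b d C hd hC y i = 0 := congrFun (LinearMap.mem_ker.1 hyk) i
        rw [oneSub_apply hd hC y i fun j hj => hy j (hi ▸ hr i j hj), ← hf, Trunc.mul_mk,
          one_mul, Trunc.mk_eq_zero] at h0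
        obtain ⟨u, rfl⟩ := h0
        exact ⟨u, fun _ => by rw [← hf, ← map_smul, smul_eq_mul, mul_comm]⟩
      choose u hu using hu
      have hz : ∑ i with r i = n, u i • h i ∈ M :=
        M.sum_mem fun i _ => M.smul_mem _ (hmem i)
      rw [← M.sub_mem_iff_left hz]
      refine ih (n + 1) (by omega) _ (Submodule.sub_mem _ hyk (hle hz)) fun i hi => ?_
      rw [Pi.sub_apply, Finset.sum_apply]
      rcases Nat.lt_succ_iff_lt_or_eq.1 hi with hlt | heq
      · rw [hy i hlt, Finset.sum_eq_zero, sub_zero]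
        intro j hj
        have hj := (Finset.mem_filter.1 hj).2
        rw [Pi.smul_apply, hother j i (by omega) (by rintro rfl; omega), smul_zero]
      · rw [Finset.sum_eq_single i, Pi.smul_apply, hself, ← hu i heq, sub_self]
        · intro j hj hji
          have hj := (Finset.mem_filter.1 hj).2
          rw [Pi.smul_apply, hother j i (by omega) hji.symm, smul_zero]
        · intro hi
          exact absurd (Finset.mem_filter.2 ⟨Finset.mem_univ i, heq⟩) hi
  exact fun y hy => key _ 0 (by rw [zero_add]; exact Nat.lt_succ_self _) y hy
    fun i hi => absurd hi (Nat.not_lt_zero _)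

end Trunc

/-! ### Submodules given by strings of columns -/

/-- A family of strings of columns, where column `i` has length `b i`. The number `place c i` is
the place of column `i` in string `c`, starting with `1`, and it is `0` if `i` does not occur
in `c`. The lengths increase along each string, and distinct strings meet only in their last
columns. -/
structure StringSystem (κ K : Type*) (b : κ → ℕ) where
  place : K → κ → ℕ
  exists_pred : ∀ c i, 2 ≤ place c i → ∃ j, place c j + 1 = place c i
  inj : ∀ c i j, place c i ≠ 0 → place c i = place c j → i = j
  lt : ∀ c i j, place c j ≠ 0 → place c i = place c j + 1 → b j < b i
  uniq : ∀ c c' i j, place c j ≠ 0 → place c i = place c j + 1 → place c' j ≠ 0 → c' = c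
  pos : ∀ c i, place c i ≠ 0 → 1 ≤ b i

namespace StringSystem

variable (k : Type u) [Field k] {κ K : Type*} {b : κ → ℕ} (σ : StringSystem κ K b)

/-- Lengths start at 1 or more and grow strictly along a string. This makes the subtraction in
`coeff` a genuine one. -/
theorem place_le (c : K) (i : κ) : σ.place c i ≤ b i := by
  have key : ∀ n i, σ.place c i = n → n ≤ b i := by
    intro n
    induction n with
    | zero => exact fun _ _ => Nat.zero_le _
    | succ n ih =>
      intro i hi
      rcases Nat.eq_zero_or_pos n with rfl | hn
      · exact σ.pos c i (by omega)
      · obtain ⟨j, hj⟩ := σ.exists_pred c i (by omega)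
        have := ih j (by omega)
        have := σ.lt c i j (by omega) hj.symm
        omega
  exact key _ i rfl

/-- The coefficients of the generator belonging to a string. -/
noncomputable def coeff (c : K) (i : κ) : k[X] :=
  if σ.place c i = 0 then 0 else X ^ (b i - σ.place c i)

/-- The generator belonging to a string. -/
noncomputable def gen (c : K) (i : κ) : Trunc k (b i) := Trunc.mk (b i) (σ.coeff k c i)

/-- The submodule generated by the generators of all strings. -/
noncomputable def sub : Submodule k[X] ((i : κ) → Trunc k (b i)) :=
  Submodule.span k[X] (Set.range (σ.gen k))

/-- Column `j` is followed by column `i` in some string. -/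
def Pred (j i : κ) : Prop := ∃ c, σ.place c j ≠ 0 ∧ σ.place c i = σ.place c j + 1

open Classical in
/-- The matrix `C` such that the submodule `X ^ e • sub` is the kernel of `1 - C`. -/
noncomputable def relMatrix (t : κ → ℕ) (e : ℕ) (i j : κ) : k[X] :=
  if e < t i ∧ σ.Pred j i then X ^ (b i - b j - 1) else 0

variable {k} {σ}

theorem pow_smul_gen_eq_zero {c : K} {i : κ} {n : ℕ} (h : σ.place c i ≤ n) :
    (X : k[X]) ^ n • σ.gen k c i = 0 := by
  rw [gen, ← map_smul, Trunc.mk_eq_zero, smul_eq_mul, coeff]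
  split_ifs with h0
  · rw [mul_zero]; exact dvd_zero _
  · rw [← pow_add]
    exact pow_dvd_pow _ (by omega)

/-- A column with a successor lies in only one string, so the matrix does not mix strings. -/
theorem place_of_relMatrix_mul_coeff_ne_zero {t : κ → ℕ} {e : ℕ} {c : K} {i j : κ}
    (h : σ.relMatrix k t e i j * σ.coeff k c j ≠ 0) :
    σ.place c j ≠ 0 ∧ σ.place c i = σ.place c j + 1 := by
  have hc : σ.place c j ≠ 0 := fun h' => right_ne_zero_of_mul h (by simp [coeff, h'])
  have hp : σ.Pred j i := by
    by_contra hp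
    exact left_ne_zero_of_mul h (by simp [relMatrix, hp])
  obtain ⟨c', h1, h2⟩ := hp
  obtain rfl := σ.uniq c' c i j h1 h2 hc
  exact ⟨h1, h2⟩

/-- Only the predecessor contributes, and the exponents add up. Place 1 is excluded: there the sum
is empty, while the coefficient `X ^ (b i - 1)` vanishes only modulo `X ^ (b i - 1)`. -/
theorem coeff_eq_sum [Fintype κ] {t : κ → ℕ} {e : ℕ} {c : K} {i : κ} (hi : e < t i)
    (h1 : σ.place c i ≠ 1) :
    σ.coeff k c i = ∑ j, σ.relMatrix k t e i j * σ.coeff k c j := by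
  by_cases h0 : σ.place c i = 0
  · rw [Finset.sum_eq_zero, coeff, if_pos h0]
    intro j _
    by_contra hj
    have := place_of_relMatrix_mul_coeff_ne_zero hj
    omega
  · obtain ⟨j, hj⟩ := σ.exists_pred c i (by omega)
    have hj0 : σ.place c j ≠ 0 := by omega
    rw [Finset.sum_eq_single j]
    · have := σ.lt c i j hj0 hj.symm
      have := σ.place_le c j
      rw [coeff, if_neg h0, coeff, if_neg hj0, relMatrix, if_pos ⟨hi, c, hj0, hj.symm⟩, ← pow_add]
      congr 1
      omega
    · intro j' _ hne
      by_contra h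
      obtain ⟨h, h'⟩ := place_of_relMatrix_mul_coeff_ne_zero h
      exact hne (σ.inj c j' j h (by omega))
    · exact fun h => absurd (Finset.mem_univ j) h

/-- Here `t i` is the largest place of column `i`, and it serves as the level for the triangular map
`1 - C`, whose kernel is `X ^ e • sub`. -/
theorem nonempty_quotient_equiv [Fintype κ] {t : κ → ℕ} (ht : ∀ c i, σ.place c i ≤ t i)
    (ht' : ∀ i, t i ≠ 0 → ∃ c, σ.place c i = t i) {e : ℕ} {d : κ → ℕ}
    (hddef : ∀ i, d i = if e < t i then b i - 1 else b i) :
    Nonempty ((((i : κ) → Trunc k (b i)) ⧸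
        (σ.sub k).map (LinearMap.lsmul k[X] _ ((X : k[X]) ^ e))) ≃ₗ[k[X]]
      ((i : κ) → Trunc k (d i))) := by
  have hd : ∀ i, d i ≤ b i := fun i => by simp only [hddef]; split_ifs <;> omega
  have hC : ∀ i j, (X : k[X]) ^ d i ∣ σ.relMatrix k t e i j * X ^ b j := by
    intro i j
    rw [relMatrix]
    split_ifs with h
    · obtain ⟨hi, c, hc, hc'⟩ := h
      have := σ.lt c i j hc hc'
      rw [← pow_add]
      exact pow_dvd_pow _ (by simp only [hddef, if_pos hi]; omega)
    · rw [zero_mul]; exact dvd_zero _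
  have hr : ∀ i j, σ.relMatrix k t e i j ≠ 0 → t j < t i := by
    intro i j h
    have hp : σ.Pred j i := by
      by_contra hp
      exact h (by simp [relMatrix, hp])
    obtain ⟨c, hc, hc'⟩ := hp
    have h1 := ht c i
    have h2 := ht c j
    -- Column `j` has a successor in `c`, so `c` is the only string through `j` and `t j` is its
    -- place there.
    obtain ⟨c', hc''⟩ := ht' j (by omega)
    obtain rfl := σ.uniq c c' i j hc hc' (by omega)
    omega
  set M := (σ.sub k).map (LinearMap.lsmul k[X] _ ((X : k[X]) ^ e)) with hMdef
  have hgen : ∀ c, (X : k[X]) ^ e • σ.gen k c ∈ M := fun c =>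
    Submodule.mem_map_of_mem (f := LinearMap.lsmul k[X] _ ((X : k[X]) ^ e))
      (Submodule.subset_span ⟨c, rfl⟩)
  have hle : M ≤ LinearMap.ker (oneSub b d (σ.relMatrix k t e) hd hC) := by
    rw [hMdef, sub, Submodule.map_span_le]
    rintro _ ⟨c, rfl⟩
    rw [LinearMap.lsmul_apply, LinearMap.mem_ker, map_smul]
    funext i
    rw [Pi.smul_apply, Pi.zero_apply, show σ.gen k c = fun i => Trunc.mk (b i) (σ.coeff k c i)
      from rfl, oneSub_mk]
    by_cases hi : e < t i
    · by_cases h1 : σ.place c i = 1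
      · rw [Finset.sum_eq_zero, sub_zero, coeff, if_neg (by omega), h1, ← map_smul,
          Trunc.mk_eq_zero]
        · simp only [hddef, if_pos hi, smul_eq_mul]
          exact dvd_mul_left _ _
        · intro j _
          by_contra hj
          have := place_of_relMatrix_mul_coeff_ne_zero hj
          omega
      · rw [← coeff_eq_sum hi h1, sub_self, map_zero, smul_zero]
    · rw [Finset.sum_eq_zero, sub_zero, ← map_smul, Trunc.mk_eq_zero,
          (hddef i).trans (if_neg hi), ← Trunc.mk_eq_zero]
      · exact pow_smul_gen_eq_zero ((ht c i).trans (not_lt.1 hi))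
      · intro j _
        rw [relMatrix, if_neg fun h => hi h.1, zero_mul]
  have heq : M = LinearMap.ker (oneSub b d (σ.relMatrix k t e) hd hC) := by
    refine le_antisymm hle (ker_oneSub_le hd hC t hr M hle fun i => ?_)
    by_cases hi : e < t i
    · obtain ⟨c, hc⟩ := ht' i (by omega)
      -- This multiple has `X ^ (b i - 1)` in column `i` and vanishes in every column of place below
      -- `t i`.
      refine ⟨(X : k[X]) ^ (t i - 1) • σ.gen k c, ?_, ?_, fun j hj hne => ?_⟩
      · rw [show t i - 1 = (t i - 1 - e) + e by omega, pow_add, mul_smul]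
        exact M.smul_mem _ (hgen c)
      · have := σ.place_le c i
        rw [Pi.smul_apply, gen, ← map_smul, coeff, if_neg (by omega), smul_eq_mul, ← pow_add]
        congr 2
        simp only [hddef, if_pos hi]
        omega
      · refine pow_smul_gen_eq_zero ?_
        have h1 := ht c j
        have h2 : σ.place c j ≠ σ.place c i := fun h => hne (σ.inj c j i (by omega) h)
        omega
    · refine ⟨0, M.zero_mem, ?_, fun _ _ _ => rfl⟩
      rw [Pi.zero_apply, eq_comm, Trunc.mk_eq_zero]
      simp only [hddef, if_neg hi, dvd_refl]
  exact ⟨(Submodule.quotEquivOfEq _ _ heq).trans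
    (LinearMap.quotKerEquivOfSurjective _ (oneSub_surjective hd hC t hr))⟩

end StringSystem

/-! ### Extensions given by idempotents -/

namespace Emb

variable {k : Type u} [Field k]

/-- The subobject `(A ∩ W ⊂ W)` of `(A ⊂ B)`. -/
noncomputable def restrict (E : Emb k) (W : Submodule k[X] E.B) : Emb k where
  B := W
  nilpotent := E.nilpotent.imp fun _ h b => Subtype.ext (h b)
  A := E.A.comap W.subtype

/-- The factor object `((A + W)/W ⊂ B/W)` of `(A ⊂ B)`. -/
noncomputable def quotient (E : Emb k) (W : Submodule k[X] E.B) : Emb k where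
  B := E.B ⧸ W
  nilpotent := E.nilpotent.imp fun _ h b => by
    obtain ⟨y, rfl⟩ := W.mkQ_surjective b
    rw [← map_smul, h, map_zero]
  A := E.A.map W.mkQ

/-- The inclusion of the subobject on `W`. -/
noncomputable def restrictHom (E : Emb k) (W : Submodule k[X] E.B) : Hom (E.restrict W) E where
  toLin := W.subtype
  maps _ h := h

/-- The projection to the factor object modulo `W`. -/
noncomputable def quotientHom (E : Emb k) (W : Submodule k[X] E.B) : Hom E (E.quotient W) where
  toLin := W.mkQ
  maps a h := ⟨a, h, rfl⟩

theorem isShortExact_restrict_quotient (E : Emb k) (W : Submodule k[X] E.B) :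
    IsShortExact (E.restrictHom W) (E.quotientHom W) := by
  have hmk : ∀ y : E.B, W.mkQ y = 0 ↔ y ∈ W := fun y => Submodule.Quotient.mk_eq_zero W
  refine ⟨⟨W.subtype_injective, fun y => ?_, W.mkQ_surjective⟩, fun x y h => ?_, fun y => ?_, ?_⟩
  · exact (hmk y).trans ⟨fun h => ⟨⟨y, h⟩, rfl⟩, fun ⟨w, hw⟩ => hw ▸ w.2⟩
  · exact Subtype.ext (W.subtype_injective (congrArg (fun z : E.A => z.1) h))
  · constructor
    · intro h
      exact ⟨⟨⟨y.1, (hmk y.1).1 (congrArg Subtype.val h)⟩, y.2⟩, rfl⟩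
    · rintro ⟨w, rfl⟩
      exact Subtype.ext ((hmk _).2 w.1.2)
  · rintro ⟨_, y, hy, rfl⟩
    exact ⟨⟨y, hy⟩, rfl⟩

/-- Changing the submodule of an object, keeping the ambient module. -/
noncomputable abbrev withSub (E : Emb k) (A : Submodule k[X] E.B) : Emb k where
  B := E.B
  nilpotent := E.nilpotent
  A := A

/-- With `W` the image of `P`, the hypotheses say that the new submodule is `(E.A ∩ W) ⊕ (1 - P)
E.A`. This is the image of subobject plus factor object under the splitting of the ambient module by
`P`; the submodule `E.A` itself need not split. -/
theorem extLE_withSub (E : Emb k) (A : Submodule k[X] E.B) (P : E.B →ₗ[k[X]] E.B)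
    (hP : ∀ y, P (P y) = P y) (h₁ : ∀ y ∈ E.A, P y = y → y ∈ A) (h₂ : ∀ y ∈ E.A, y - P y ∈ A)
    (h₃ : ∀ y ∈ A, P y ∈ E.A) (h₄ : ∀ y ∈ A, ∃ a ∈ E.A, a - P a = y - P y) :
    ExtLE E (E.withSub A) := by
  set W := LinearMap.range P with hWdef
  have hW : ∀ y, y ∈ W ↔ P y = y := fun y => ⟨fun ⟨z, hz⟩ => hz ▸ hP z, fun h => ⟨y, h⟩⟩
  let Q : (E.B ⧸ W) →ₗ[k[X]] E.B := W.liftQ (LinearMap.id - P) <| by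
    intro y hy
    rw [LinearMap.mem_ker, LinearMap.sub_apply, LinearMap.id_apply, (hW y).1 hy, sub_self]
  have hQ : ∀ y, Q (W.mkQ y) = y - P y := fun _ => rfl
  have hPQ : ∀ y, P (Q y) = 0 := fun y => by
    obtain ⟨y, rfl⟩ := W.mkQ_surjective y
    rw [hQ, map_sub, hP, sub_self]
  have hbij : Function.Bijective (W.subtype.coprod Q) := by
    constructor
    · rw [injective_iff_map_eq_zero]
      rintro ⟨w, y⟩ h
      rw [LinearMap.coprod_apply, Submodule.subtype_apply] at h
      have hw : (w : E.B) = 0 := by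
        have := congrArg P h
        rwa [map_add, (hW w).1 w.2, hPQ, add_zero, map_zero] at this
      rw [hw, zero_add] at h
      obtain ⟨y, rfl⟩ := W.mkQ_surjective y
      rw [hQ, sub_eq_zero] at h
      exact Prod.ext (Subtype.ext hw) ((Submodule.Quotient.mk_eq_zero W).2 ((hW y).2 h.symm))
    · intro y
      refine ⟨(⟨P y, y, rfl⟩, W.mkQ y), ?_⟩
      rw [LinearMap.coprod_apply, Submodule.subtype_apply, hQ, add_sub_cancel]
  refine ⟨1, fun i => if i = 0 then E else E.withSub A, ⟨LinearEquiv.refl _ _, fun _ => Iff.rfl⟩,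
    ⟨LinearEquiv.refl _ _, fun _ => Iff.rfl⟩, fun i hi => ?_⟩
  obtain rfl : i = 0 := by omega
  refine ⟨E.restrict W, E.quotient W, E.restrictHom W, E.quotientHom W,
    E.isShortExact_restrict_quotient W, LinearEquiv.ofBijective _ hbij, ?_⟩
  rintro ⟨(w : W), (y : E.B ⧸ W)⟩
  change (w : E.B) ∈ E.A ∧ y ∈ E.A.map W.mkQ ↔ (w : E.B) + Q y ∈ A
  obtain ⟨y, rfl⟩ := W.mkQ_surjective y
  constructor
  · rintro ⟨hw, a, ha, hay⟩
    rw [← hay]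
    exact A.add_mem (h₁ _ hw ((hW _).1 w.2)) (h₂ a ha)
  · intro h
    have hPw : P (w + Q (W.mkQ y)) = w := by rw [map_add, hPQ, add_zero, (hW w).1 w.2]
    refine ⟨hPw ▸ h₃ _ h, ?_⟩
    obtain ⟨a, ha, hay⟩ := h₄ _ h
    refine ⟨a, ha, hbij.injective.comp (Prod.mk_right_injective (0 : W)) ?_⟩
    rw [hPw, add_sub_cancel_left] at hay
    exact congrArg (W.subtype 0 + ·) hay

end Emb

/-- As `φ` kills all generators except `g T`, it controls the coefficient with which `g T` enters `P
y`. -/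
theorem exists_coeff_of_mem_span_range {R M N K : Type*} [CommRing R] [AddCommGroup M] [Module R M]
    [AddCommGroup N] [Module R N] {g : K → M} (φ : M →ₗ[R] N) (P : M →ₗ[R] M) {S T : K}
    (hφ : ∀ c, c ≠ T → φ (g c) = 0) (hS : P (g S) = g S)
    (hP : ∀ c, c ≠ S → c ≠ T → P (g c) = 0) {y : M} (hy : y ∈ Submodule.span R (Set.range g)) :
    ∃ d e : R, φ y = d • φ (g T) ∧ P y = e • g S + d • P (g T) := by
  induction hy using Submodule.span_induction with
  | mem y hy =>
    obtain ⟨c, rfl⟩ := hy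
    by_cases hcT : c = T
    · exact ⟨1, 0, by rw [hcT, one_smul], by rw [hcT, one_smul, zero_smul, zero_add]⟩
    · by_cases hcS : c = S
      · exact ⟨0, 1, by rw [hφ c hcT, zero_smul],
          by rw [hcS, one_smul, zero_smul, add_zero, hS]⟩
      · exact ⟨0, 0, by rw [hφ c hcT, zero_smul],
          by rw [hP c hcS hcT, zero_smul, zero_smul, add_zero]⟩
  | zero => exact ⟨0, 0, by simp, by simp⟩
  | add y z _ _ hy hz =>
    obtain ⟨d, e, h1, h2⟩ := hy
    obtain ⟨d', e', h1', h2'⟩ := hz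
    refine ⟨d + d', e + e', by rw [map_add, h1, h1', add_smul], ?_⟩
    rw [map_add, h2, h2', add_smul, add_smul]
    abel
  | smul a y _ hy =>
    obtain ⟨d, e, h1, h2⟩ := hy
    refine ⟨a * d, a * e, by rw [map_smul, h1, mul_smul], ?_⟩
    rw [map_smul, h2, smul_add, mul_smul, mul_smul]

/-! ### Attaching a column to several strings -/

/-- A decomposition into strings of the columns different from `m`. The string of column `i` is
`str i`, and `place i` is its place therein, which is `0` if `i` does not belong to a string. -/
structure Strings (κ K : Type*) (b : κ → ℕ) (m : κ) where
  place : κ → ℕ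
  str : κ → K
  pos : ∀ i, 1 ≤ place i → 1 ≤ b i
  exists_pred : ∀ i ≠ m, 2 ≤ place i → ∃ j ≠ m, str j = str i ∧ place j + 1 = place i
  inj : ∀ i ≠ m, ∀ j ≠ m, place i ≠ 0 → place i = place j → str i = str j → i = j
  lt : ∀ i ≠ m, ∀ j ≠ m, place j ≠ 0 → place i = place j + 1 → str i = str j → b j < b i

namespace Strings

variable {κ K : Type*} {b : κ → ℕ} {m : κ} (σ : Strings κ K b m)

/-- The column `m` can be attached to the strings `c` with `w c ≠ 0`, at the place `w c`. -/
structure Attachable (w : K → ℕ) : Prop where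
  lt_of_str : ∀ c, w c ≠ 0 → ∀ i ≠ m, σ.str i = c → σ.place i < w c
  exists_pred : ∀ c, 2 ≤ w c → ∃ j ≠ m, σ.str j = c ∧ σ.place j + 1 = w c
  lt : ∀ j ≠ m, σ.place j ≠ 0 → σ.place j + 1 = w (σ.str j) → b j < b m

variable [DecidableEq κ] [DecidableEq K]

/-- The string system obtained by attaching the column `m` to the strings `c` with `w c ≠ 0`. -/
def attach (hm : 1 ≤ b m) (w : K → ℕ) (hw : σ.Attachable w) : StringSystem κ K b where
  place c i := if i = m then w c else if σ.str i = c then σ.place i else 0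
  exists_pred c i h := by
    split_ifs at h with h1 h2
    · obtain ⟨j, hj, hjc, hj1⟩ := hw.exists_pred c h
      exact ⟨j, by rw [if_neg hj, if_pos hjc, if_pos h1, hj1]⟩
    · obtain ⟨j, hj, hjc, hj1⟩ := σ.exists_pred i h1 h
      exact ⟨j, by rw [if_neg hj, if_pos (hjc.trans h2), if_neg h1, if_pos h2, hj1]⟩
    · omega
  inj c i j h h' := by
    have := hw.lt_of_str c
    by_cases hi : i = m <;> by_cases hj : j = m
    · rw [hi, hj]
    · simp only [if_pos hi, if_neg hj] at h h'
      split_ifs at h' with h2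
      · exact absurd (this h j hj h2) (by omega)
      · exact absurd h' h
    · simp only [if_neg hi, if_pos hj] at h h'
      split_ifs at h h' with h2
      · exact absurd (this (by omega) i hi h2) (by omega)
      · exact absurd rfl h
    · simp only [if_neg hi, if_neg hj] at h h'
      split_ifs at h h' with h2 h3
      · exact σ.inj i hi j hj h h' (h2.trans h3.symm)
      · exact absurd h' h
      · exact absurd rfl h
      · exact absurd rfl h
  lt c i j h h' := by
    have := hw.lt_of_str c
    by_cases hi : i = m <;> by_cases hj : j = m
    · simp only [if_pos hi, if_pos hj] at h'
      omega
    · simp only [if_neg hj, if_pos hi] at h h'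
      split_ifs at h h' with h2
      · exact hi ▸ hw.lt j hj h (by rw [h2, h'])
      · exact absurd rfl h
    · simp only [if_pos hj, if_neg hi] at h h'
      split_ifs at h' with h2
      exact absurd (this h i hi h2) (by omega)
    · simp only [if_neg hi, if_neg hj] at h h'
      split_ifs at h h' with h2 h3
      · exact σ.lt i hi j hj h h' (h3.trans h2.symm)
      · exact absurd rfl h
  uniq c c' i j h h' h'' := by
    have := hw.lt_of_str c
    by_cases hj : j = m
    · simp only [if_pos hj] at h h'
      by_cases hi : i = m
      · rw [if_pos hi] at h'; omega
      · rw [if_neg hi] at h'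
        split_ifs at h' with h2
        exact absurd (this h i hi h2) (by omega)
    · simp only [if_neg hj] at h h''
      rw [ne_eq, ite_eq_right_iff, not_forall] at h h''
      exact h''.1.symm.trans h.1
  pos c i h := by
    split_ifs at h with h1 h2
    · exact h1 ▸ hm
    · exact σ.pos i (by omega)
    · exact absurd rfl h

end Strings

/-! ### The exact sequence relating attachment to two strings and to one -/

section Extension

variable {k : Type u} [Field k]

/-- The object given by a submodule of a finite sum of truncated polynomial rings. -/
noncomputable abbrev truncEmb {κ : Type} [Fintype κ] (b : κ → ℕ)
    (A : Submodule k[X] ((i : κ) → Trunc k (b i))) : Emb k where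
  B := (i : κ) → Trunc k (b i)
  nilpotent := by
    refine ⟨Finset.univ.sup b, fun y => funext fun i => ?_⟩
    obtain ⟨f, hf⟩ := Trunc.mk_surjective _ (y i)
    rw [Pi.smul_apply, ← hf, ← map_smul, Pi.zero_apply, Trunc.mk_eq_zero, smul_eq_mul]
    exact (pow_dvd_pow _ (Finset.le_sup (Finset.mem_univ i))).mul_right _
  A := A

variable {κ K : Type} [Fintype κ] [DecidableEq κ] [DecidableEq K] {b : κ → ℕ} {m : κ}
  (σ : Strings κ K b m)

/-- `P` projects onto `m` and the columns of `S`. The main point is that `A ∩ im P` is generated by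
the generator of `S`: an element there vanishes at the predecessor of `m` in `T`, so `X ^ (q - 1)`
divides its coefficient at the generator of `T`, and that multiple projects into the span of the
generator of `S`. -/
theorem Strings.extLE_attach (hm : 1 ≤ b m) {S T : K} (hST : S ≠ T) {p q : ℕ} (hp : 1 ≤ p)
    (hpq : p < q)
    (hw : σ.Attachable fun c => if c = S then p else if c = T then q else 0)
    (hw' : σ.Attachable fun c => if c = S then p else 0) :
    Emb.ExtLE (truncEmb b ((σ.attach hm _ hw).sub k)) (truncEmb b ((σ.attach hm _ hw').sub k)) := by
  set τ := σ.attach hm _ hw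
  set τ' := σ.attach hm _ hw'
  let P : ((i : κ) → Trunc k (b i)) →ₗ[k[X]] ((i : κ) → Trunc k (b i)) :=
    LinearMap.pi fun i => if i = m ∨ σ.str i = S then LinearMap.proj i else 0
  have hPpos : ∀ y i, i = m ∨ σ.str i = S → P y i = y i := fun y i h => by
    simp only [P, LinearMap.pi_apply, if_pos h, LinearMap.proj_apply]
  have hPneg : ∀ y i, ¬ (i = m ∨ σ.str i = S) → P y i = 0 := fun y i h => by
    simp only [P, LinearMap.pi_apply, if_neg h, LinearMap.zero_apply]
  have hPP : ∀ y, P (P y) = P y := fun y => funext fun i => by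
    by_cases h : i = m ∨ σ.str i = S
    · rw [hPpos _ _ h]
    · rw [hPneg _ _ h, hPneg _ _ h]
  have gen_zero : ∀ (ρ : StringSystem κ K b) c i, ρ.place c i = 0 → ρ.gen k c i = 0 :=
    fun ρ c i h => by rw [StringSystem.gen, StringSystem.coeff, if_pos h, map_zero]
  have gen_congr : ∀ c i, τ.place c i = τ'.place c i → τ.gen k c i = τ'.gen k c i :=
    fun c i h => by rw [StringSystem.gen, StringSystem.coeff, h]; rfl
  have place_ne : ∀ c i, i ≠ m → τ.place c i = if σ.str i = c then σ.place i else 0 :=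
    fun c i hi => if_neg hi
  have place_ne' : ∀ c i, i ≠ m → τ'.place c i = if σ.str i = c then σ.place i else 0 :=
    fun c i hi => if_neg hi
  have place_m : ∀ c, τ.place c m = if c = S then p else if c = T then q else 0 :=
    fun c => if_pos rfl
  have place_m' : ∀ c, τ'.place c m = if c = S then p else 0 := fun c => if_pos rfl
  have genS : τ'.gen k S = τ.gen k S := funext fun i => Eq.symm <| gen_congr S i <| by
    by_cases hi : i = m
    · rw [hi, place_m, place_m', if_pos rfl, if_pos rfl]
    · rw [place_ne _ _ hi, place_ne' _ _ hi]
  have P_genS : P (τ.gen k S) = τ.gen k S := funext fun i => by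
    by_cases h : i = m ∨ σ.str i = S
    · exact hPpos _ _ h
    · rw [hPneg _ _ h, gen_zero]
      rw [not_or] at h
      rw [place_ne _ _ h.1, if_neg h.2]
  have gen_other : ∀ c, c ≠ S → τ'.gen k c = τ.gen k c - P (τ.gen k c) := fun c hc =>
    funext fun i => by
      rw [Pi.sub_apply]
      by_cases h : i = m ∨ σ.str i = S
      · rw [hPpos _ _ h, sub_self, gen_zero]
        by_cases hi : i = m
        · rw [hi, place_m', if_neg hc]
        · rw [place_ne' _ _ hi, if_neg]
          rintro rfl
          exact hc (h.resolve_left hi)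
      · rw [hPneg _ _ h, sub_zero, gen_congr]
        rw [not_or] at h
        rw [place_ne _ _ h.1, place_ne' _ _ h.1]
  have P_other : ∀ c, c ≠ S → c ≠ T → P (τ.gen k c) = 0 := fun c hc hcT =>
    funext fun i => by
      by_cases h : i = m ∨ σ.str i = S
      · rw [hPpos _ _ h, gen_zero]; · rfl
        by_cases hi : i = m
        · rw [hi, place_m, if_neg hc, if_neg hcT]
        · rw [place_ne _ _ hi, if_neg]
          rintro rfl
          exact hc (h.resolve_left hi)
      · exact hPneg _ _ h
  have mem : ∀ (ρ : StringSystem κ K b) c, ρ.gen k c ∈ ρ.sub k :=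
    fun ρ c => Submodule.subset_span ⟨c, rfl⟩
  refine Emb.extLE_withSub (truncEmb b (τ.sub k)) (τ'.sub k) P hPP ?_ ?_ ?_ ?_
  -- From `1 ≤ p < q` follows `q ≥ 2`, so `m` has a predecessor `l` in `T`.
  · obtain ⟨l, hlm, hlT, hl⟩ := hw.exists_pred T (by rw [if_neg hST.symm, if_pos rfl]; omega)
    rw [if_neg hST.symm, if_pos rfl] at hl
    have hl0 : ∀ c, c ≠ T → τ.gen k c l = 0 := fun c hc => gen_zero _ _ _ <| by
      rw [place_ne _ _ hlm, if_neg]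
      rintro rfl
      exact hc hlT
    intro y hy hPy
    obtain ⟨d, e, h1, h2⟩ :=
      exists_coeff_of_mem_span_range (LinearMap.proj l) P hl0 P_genS P_other hy
    rw [LinearMap.proj_apply, LinearMap.proj_apply] at h1
    have hyl : y l = 0 := by
      rw [← hPy]
      refine hPneg y l ?_
      rw [hlT]
      exact fun h => h.elim hlm hST.symm
    have hd : (X : k[X]) ^ (q - 1) ∣ d := by
      have hplace : τ.place T l = q - 1 := by rw [place_ne _ _ hlm, if_pos hlT]; omega
      have hle := τ.place_le T l
      rw [hyl, eq_comm, StringSystem.gen, ← map_smul, Trunc.mk_eq_zero, StringSystem.coeff,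
        if_neg (by omega), hplace, smul_eq_mul] at h1
      rw [show b l = (q - 1) + (b l - (q - 1)) by omega, pow_add,
        show (q - 1) + (b l - (q - 1)) - (q - 1) = b l - (q - 1) by omega] at h1
      exact (mul_dvd_mul_iff_right (pow_ne_zero _ X_ne_zero)).1 h1
    obtain ⟨d, rfl⟩ := hd
    -- Both sides have `X ^ (b m - 1)` at `m`. The other columns of `S` have places below `p`, so `X
    -- ^ (p - 1)` kills their components.
    have hPT : (X : k[X]) ^ (q - 1) • P (τ.gen k T) = (X : k[X]) ^ (p - 1) • τ.gen k S := by
      funext i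
      rw [Pi.smul_apply, Pi.smul_apply]
      by_cases hi : i = m
      · subst hi
        have h3 := place_m S
        have h4 := place_m T
        have h5 := τ.place_le T i
        rw [if_pos rfl] at h3
        rw [if_neg hST.symm, if_pos rfl] at h4
        rw [hPpos _ _ (Or.inl rfl), StringSystem.gen, StringSystem.gen, ← map_smul, ← map_smul,
          StringSystem.coeff, StringSystem.coeff, h3, h4, if_neg (by omega), if_neg (by omega),
          smul_eq_mul, smul_eq_mul, ← pow_add, ← pow_add]
        congr 2
        omega
      · have h3 : P (τ.gen k T) i = 0 := by
          by_cases h : σ.str i = S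
          · rw [hPpos _ _ (Or.inr h)]
            exact gen_zero _ _ _ (by rw [place_ne _ _ hi, if_neg (h ▸ hST)])
          · exact hPneg _ _ (not_or.2 ⟨hi, h⟩)
        rw [h3, smul_zero, StringSystem.pow_smul_gen_eq_zero]
        rw [place_ne _ _ hi]
        split_ifs with h
        · have := hw'.lt_of_str S (by rw [if_pos rfl]; omega) i hi h
          rw [if_pos rfl] at this
          omega
        · omega
    rw [← hPy, h2, mul_comm, mul_smul, hPT, ← genS]
    exact Submodule.add_mem _ (Submodule.smul_mem _ _ (mem τ' S))
      (Submodule.smul_mem _ _ (Submodule.smul_mem _ _ (mem τ' S)))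
  · change τ.sub k ≤ (τ'.sub k).comap (LinearMap.id - P)
    rw [StringSystem.sub, Submodule.span_le]
    rintro _ ⟨c, rfl⟩
    change τ.gen k c - P (τ.gen k c) ∈ τ'.sub k
    by_cases hc : c = S
    · rw [hc, P_genS, sub_self]
      exact Submodule.zero_mem _
    · rw [← gen_other c hc]
      exact mem τ' c
  · change τ'.sub k ≤ (τ.sub k).comap P
    rw [StringSystem.sub, Submodule.span_le]
    rintro _ ⟨c, rfl⟩
    change P (τ'.gen k c) ∈ τ.sub k
    by_cases hc : c = S
    · rw [hc, genS, P_genS]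
      exact mem τ S
    · rw [gen_other c hc, map_sub, hPP, sub_self]
      exact Submodule.zero_mem _
  · change τ'.sub k ≤ ((τ.sub k).map (LinearMap.id - P)).comap (LinearMap.id - P)
    rw [StringSystem.sub, Submodule.span_le]
    rintro _ ⟨c, rfl⟩
    refine ⟨τ.gen k c, mem τ c, ?_⟩
    change τ.gen k c - P (τ.gen k c) = τ'.gen k c - P (τ'.gen k c)
    by_cases hc : c = S
    · rw [hc, genS]
    · rw [gen_other c hc, map_sub, hPP, sub_self, sub_zero]

end Extension

/-! ### Decomposing columns into strings -/

section Chains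

variable {κ : Type*}

/-- A map `π` sends the elements with `t i ≥ 2` injectively to elements where `t` is smaller by
one and `b` is smaller. -/
structure IsMatching (t b : κ → ℕ) (D : Set κ) (π : κ → κ) : Prop where
  mem : ∀ i ∈ D, 2 ≤ t i → π i ∈ D
  succ : ∀ i ∈ D, 2 ≤ t i → t (π i) + 1 = t i
  lt : ∀ i ∈ D, 2 ≤ t i → b (π i) < b i
  inj : ∀ i ∈ D, ∀ j ∈ D, 2 ≤ t i → t i = t j → π i = π j → i = j

namespace IsMatching

variable {t b : κ → ℕ} {D : Set κ} {π : κ → κ}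

theorem iterate (h : IsMatching t b D π) {i : κ} (hi : i ∈ D) {n : ℕ} (hn : n + 1 ≤ t i) :
    π^[n] i ∈ D ∧ t (π^[n] i) + n = t i := by
  induction n with
  | zero => exact ⟨hi, rfl⟩
  | succ n ih =>
    obtain ⟨h1, h2⟩ := ih (by omega)
    rw [Function.iterate_succ_apply']
    have := h.succ _ h1 (by omega)
    exact ⟨h.mem _ h1 (by omega), by omega⟩

/-- Since `π` is injective on each level, a column is determined by its level and the root reached
by iterating `π`. -/
theorem eq_of_root_eq (h : IsMatching t b D π) {i j : κ} (hi : i ∈ D) (hj : j ∈ D)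
    (h0 : t i ≠ 0) (hij : t i = t j)
    (hr : π^[t i - 1] i = π^[t j - 1] j) : i = j := by
  have key : ∀ n i j, i ∈ D → j ∈ D → t i = n + 1 → t j = n + 1 → π^[n] i = π^[n] j → i = j := by
    intro n
    induction n with
    | zero => exact fun i j _ _ _ _ h => h
    | succ n ih =>
      intro i j hi hj hti htj hr
      have h1 := h.succ i hi (by omega)
      have h2 := h.succ j hj (by omega)
      exact h.inj i hi j hj (by omega) (by omega)
        (ih _ _ (h.mem i hi (by omega)) (h.mem j hj (by omega)) (by omega) (by omega) hr)
  exact key (t i - 1) i j hi hj (by omega) (by omega) (by rw [hr, hij])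

/-- Descend from `i` to level `t l + 1`; the next image has the level and the root of `l`, hence
equals `l`. -/
theorem exists_of_root_eq (h : IsMatching t b D π) {i l : κ} (hi : i ∈ D) (hl : l ∈ D)
    (h0 : t l ≠ 0) (hli : t l < t i)
    (hr : π^[t i - 1] i = π^[t l - 1] l) : ∃ j ∈ D, t j = t l + 1 ∧ π j = l := by
  obtain ⟨h1, h2⟩ := h.iterate hi (n := t i - t l - 1) (by omega)
  refine ⟨_, h1, by omega, ?_⟩
  have h3 := h.succ _ h1 (by omega)
  refine h.eq_of_root_eq (h.mem _ h1 (by omega)) hl (by omega) (by omega) ?_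
  rw [← hr, ← Function.iterate_succ_apply' π, ← Function.iterate_add_apply]
  rw [← Function.iterate_succ_apply' π] at h3
  congr 1
  omega

/-- The decomposition into strings given by a matching. -/
def strings {m : κ} (h : IsMatching t b {i | i ≠ m} π) (hb : ∀ i, 1 ≤ t i → 1 ≤ b i) :
    Strings κ (Option κ) b m where
  place := t
  -- A string is named by its column of place 1; `none` remains free as the name of an empty string.
  -- If `t i = 0` the name is `i` itself, which is harmless.
  str i := some (π^[t i - 1] i)
  pos := hb
  exists_pred i hi h2 := by
    have h1 := h.succ i hi h2
    refine ⟨π i, h.mem i hi h2, ?_, h1⟩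
    rw [← Function.iterate_succ_apply]
    congr 2
    omega
  inj i hi j hj h0 hij hr := h.eq_of_root_eq hi hj h0 hij (Option.some_injective _ hr)
  lt i hi j hj h0 hij hr := by
    have h1 := h.succ i hi (by omega)
    have : π i = j := by
      refine h.eq_of_root_eq (h.mem i hi (by omega)) hj (by omega) (by omega) ?_
      rw [← Option.some_injective _ hr, ← Function.iterate_succ_apply]
      congr 1
      omega
    exact this ▸ h.lt i hi (by omega)

end IsMatching

end Chains

/-! ### Free ends of strings and mixed matchings -/

namespace Strings

variable {κ K : Type*} {b : κ → ℕ} {m : κ}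

/-- The column `m` can be attached to the string `c` at the place `n`. -/
structure IsFree (σ : Strings κ K b m) (c : K) (n : ℕ) : Prop where
  lt_of_str : ∀ i ≠ m, σ.str i = c → σ.place i < n
  exists_pred : 2 ≤ n → ∃ j ≠ m, σ.str j = c ∧ σ.place j + 1 = n
  lt : ∀ j ≠ m, σ.str j = c → σ.place j ≠ 0 → σ.place j + 1 = n → b j < b m

theorem attachable_of_isFree (σ : Strings κ K b m) {w : K → ℕ}
    (h : ∀ c, w c ≠ 0 → σ.IsFree c (w c)) : σ.Attachable w where
  lt_of_str c hc := (h c hc).lt_of_str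
  exists_pred c hc := (h c (by omega)).exists_pred hc
  lt j hj h0 h1 := (h (σ.str j) (by omega)).lt j hj rfl h0 h1

end Strings

theorem IsMatching.isFree {κ : Type*} {t b : κ → ℕ} {m : κ} {π : κ → κ}
    (h : IsMatching t b {i | i ≠ m} π) (hb : ∀ i, 1 ≤ t i → 1 ≤ b i) {l : κ} (hlm : l ≠ m)
    (hl : t l ≠ 0) (hlt : b l < b m) (hfree : ∀ j ≠ m, t j = t l + 1 → π j ≠ l) :
    (h.strings hb).IsFree (some (π^[t l - 1] l)) (t l + 1) where
  lt_of_str i hi hc := by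
    by_contra hlt
    obtain ⟨j, hj, hj1, hj2⟩ := h.exists_of_root_eq hi hlm hl (not_lt.1 hlt)
      (Option.some_injective _ hc)
    exact hfree j hj hj1 hj2
  exists_pred _ := ⟨l, hlm, rfl, rfl⟩
  lt j hj hc h0 h1 := by
    obtain rfl := h.eq_of_root_eq hj hlm h0 (Nat.succ_injective h1) (Option.some_injective _ hc)
    exact hlt

theorem exists_strings {κ : Type*} {t t' b : κ → ℕ} {m : κ} {π π' : κ → κ}
    (h : IsMatching t b Set.univ π) (h' : IsMatching t' b Set.univ π')
    (hb : ∀ i, 1 ≤ t i → 1 ≤ b i) (htt' : ∀ i ≠ m, t' i = t i) (hm : 1 ≤ t m)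
    (hlt : t m < t' m) :
    ∃ σ : Strings κ (Option κ) b m, σ.place = t ∧
      ∃ S T, S ≠ T ∧ σ.IsFree S (t m) ∧ σ.IsFree T (t' m) := by
  classical
  -- At level `t m` the map `π`, and at level `t' m` the map `π'`, leaves the predecessor of `m`
  -- free for `m`. At level `t m + 1` only `π` can hit `m`, at level `t' m + 1` only `π'`, so the
  -- other map is taken. Elsewhere the choice is immaterial.
  let ρ : κ → κ := fun i => if t i = t m ∨ t i = t' m + 1 then π i else π' i
  have hρ : ∀ i, t i = t m ∨ t i = t' m + 1 → ρ i = π i := fun i hi => if_pos hi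
  have hρ' : ∀ i, ¬ (t i = t m ∨ t i = t' m + 1) → ρ i = π' i := fun i hi => if_neg hi
  have hmatch : IsMatching t b {i | i ≠ m} ρ := by
    have key : ∀ i ≠ m, 2 ≤ t i → ρ i ≠ m ∧ t (ρ i) + 1 = t i ∧ b (ρ i) < b i := by
      intro i hi h2
      by_cases hc : t i = t m ∨ t i = t' m + 1
      · rw [hρ i hc]
        have h3 := h.succ i trivial h2
        refine ⟨fun h4 => ?_, h3, h.lt i trivial h2⟩
        rw [h4] at h3
        omega
      · rw [hρ' i hc]
        have hti := htt' i hi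
        have h3 := h'.succ i trivial (by omega)
        have h4 : π' i ≠ m := fun h4 => by
          rw [h4] at h3
          omega
        exact ⟨h4, by rw [← htt' _ h4, h3, hti], h'.lt i trivial (by omega)⟩
    refine ⟨fun i hi h2 => (key i hi h2).1, fun i hi h2 => (key i hi h2).2.1,
      fun i hi h2 => (key i hi h2).2.2, fun i hi j hj h2 hij he => ?_⟩
    by_cases hc : t i = t m ∨ t i = t' m + 1
    · rw [hρ i hc, hρ j (hij ▸ hc)] at he
      exact h.inj i trivial j trivial h2 hij he
    · rw [hρ' i hc, hρ' j (hij ▸ hc)] at he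
      have hti := htt' i hi
      have htj := htt' j hj
      exact h'.inj i trivial j trivial (by omega) (by omega) he
  have hl := h'.succ m trivial (by omega)
  have hlm : π' m ≠ m := fun he => by
    rw [he] at hl
    omega
  have htl := htt' _ hlm
  have hT := hmatch.isFree hb hlm (by omega) (h'.lt m trivial (by omega)) fun j hj hj1 hj2 => by
    have htj := htt' j hj
    rw [hρ' j (by omega)] at hj2
    exact hj (h'.inj j trivial m trivial (by omega) (by omega) hj2)
  rw [← htl, hl, htl] at hT
  refine ⟨hmatch.strings hb, rfl, ?_⟩
  -- For `t m = 1` the column `m` starts the empty string `none`.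
  by_cases h1 : t m = 1
  · refine ⟨none, _, (Option.some_ne_none _).symm, ⟨?_, ?_, ?_⟩, hT⟩
    · exact fun i _ hi => absurd hi (Option.some_ne_none _)
    · intro h2
      omega
    · exact fun i _ hi => absurd hi (Option.some_ne_none _)
  · have hp := h.succ m trivial (by omega)
    have hpm : π m ≠ m := fun he => by
      rw [he] at hp
      omega
    have hfree : ∀ j ≠ m, t j = t (π m) + 1 → ρ j ≠ π m := fun j hj hj1 hj2 => by
      rw [hρ j (by omega)] at hj2
      exact hj (h.inj j trivial m trivial (by omega) (by omega) hj2)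
    have hS := hmatch.isFree hb hpm (by omega) (h.lt m trivial (by omega)) hfree
    rw [hp] at hS
    -- `S` ends at place `t m - 1`, while `T` has a column at place `t' m - 1`, which is larger.
    refine ⟨_, _, fun he => ?_, hS, hT⟩
    obtain ⟨j, hj, hj1, hj2⟩ := hmatch.exists_of_root_eq hlm hpm (by omega) (by omega)
      (Option.some_injective _ he).symm
    exact hfree j hj hj1 hj2

/-- Hall's condition for a set `s` already follows from the neighbours of its minimum `c`, since `s`
lies in the part of `Q` above `c`. -/
theorem exists_injOn_le {α : Type*} [Fintype α] [LinearOrder α] (P Q : Finset α)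
    (h : ∀ c, (Q.filter (c ≤ ·)).card ≤ (P.filter (c ≤ ·)).card) :
    ∃ f : α → α, Set.InjOn f Q ∧ ∀ j ∈ Q, f j ∈ P ∧ j ≤ f j := by
  obtain ⟨f, hf, hfmem⟩ := (Finset.all_card_le_biUnion_card_iff_exists_injective
    (fun j : Q => P.filter (j.1 ≤ ·))).1 <| by
      intro s
      rcases s.eq_empty_or_nonempty with rfl | hs
      · simp
      · set c := s.min' hs
        calc s.card = (s.map (Function.Embedding.subtype _)).card := (Finset.card_map _).symm
          _ ≤ (Q.filter (c.1 ≤ ·)).card := by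
            refine Finset.card_le_card fun j hj => ?_
            obtain ⟨i, hi, rfl⟩ := Finset.mem_map.1 hj
            exact Finset.mem_filter.2 ⟨i.2, s.min'_le i hi⟩
          _ ≤ (P.filter (c.1 ≤ ·)).card := h c.1
          _ ≤ _ := Finset.card_le_card
            (Finset.subset_biUnion_of_mem (fun j : Q => P.filter (j.1 ≤ ·)) (s.min'_mem hs))
  refine ⟨fun j => if hj : j ∈ Q then f ⟨j, hj⟩ else j, fun i hi j hj hij => ?_, fun j hj => ?_⟩
  · have hi' : i ∈ Q := hi
    have hj' : j ∈ Q := hj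
    simp only [dif_pos hi', dif_pos hj'] at hij
    exact congrArg Subtype.val (hf hij)
  · simp only [dif_pos hj]
    exact Finset.mem_filter.1 (hfmem ⟨j, hj⟩)

/-! ### The columns of a tableau on a rook strip -/

namespace LRTableau

variable {β γ : YoungDiagram} (Γ : LRTableau β γ)

/-- The entry in the column `j`, which is `0` if there is none. -/
def colEntry (j : ℕ) : ℕ := Γ.entry (γ.colLen j) j

variable {Γ}

theorem colLen_of_colEntry_ne_zero (hrook : IsRookStrip β γ) {j : ℕ} (h : Γ.colEntry j ≠ 0) :
    β.colLen j = γ.colLen j + 1 := by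
  have h1 : (γ.colLen j, j) ∈ β := by
    by_contra hn
    exact h (Γ.zero _ _ (Or.inl hn))
  have h2 := hrook.2.1 j
  have h3 := YoungDiagram.mem_iff_lt_colLen.1 h1
  omega

theorem entry_eq (hrook : IsRookStrip β γ) {i j : ℕ} (h : Γ.entry i j ≠ 0) :
    i = γ.colLen j ∧ j < β.rowLen 0 := by
  have h1 : (i, j) ∈ β := by
    by_contra hn
    exact h (Γ.zero _ _ (Or.inl hn))
  have h2 : (i, j) ∉ γ := fun hn => h (Γ.zero _ _ (Or.inr hn))
  have h3 := hrook.2.1 j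
  refine ⟨?_, YoungDiagram.mem_iff_lt_rowLen.1 (β.up_left_mem (Nat.zero_le i) le_rfl h1)⟩
  rw [YoungDiagram.mem_iff_lt_colLen] at h1 h2
  omega

/-- If the lengths were equal, the two cells would lie in the same row. -/
theorem colLen_lt_colLen (hrook : IsRookStrip β γ) {j j' : ℕ} (hjj' : j < j')
    (h : Γ.colEntry j ≠ 0) (h' : Γ.colEntry j' ≠ 0) : β.colLen j' < β.colLen j := by
  have h1 := colLen_of_colEntry_ne_zero hrook h
  have h2 := colLen_of_colEntry_ne_zero hrook h'
  refine lt_of_le_of_ne (β.colLen_anti _ _ hjj'.le) fun he => ?_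
  have h3 := YoungDiagram.mem_iff_lt_rowLen.1
    (YoungDiagram.mem_iff_lt_colLen.2 (by omega : γ.colLen j < β.colLen j'))
  have h4 : ¬ j < γ.rowLen (γ.colLen j) := fun hn => by
    rw [← YoungDiagram.mem_iff_lt_rowLen, YoungDiagram.mem_iff_lt_colLen] at hn
    omega
  have h5 := hrook.2.2 (γ.colLen j)
  omega

theorem card_filter_entry (hrook : IsRookStrip β γ) (c : ℕ) {e : ℕ} (he : e ≠ 0) :
    (β.cells.filter fun x => c ≤ x.2 ∧ Γ.entry x.1 x.2 = e).card =
      (Finset.univ.filter fun j : Fin (β.rowLen 0) => c ≤ j ∧ Γ.colEntry j = e).card := by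
  symm
  refine Finset.card_bij (fun j _ => (γ.colLen j, (j : ℕ))) ?_ ?_ ?_
  · intro j hj
    obtain ⟨h1, h2⟩ := (Finset.mem_filter.1 hj).2
    refine Finset.mem_filter.2 ⟨?_, h1, h2⟩
    rw [YoungDiagram.mem_cells, YoungDiagram.mem_iff_lt_colLen,
      colLen_of_colEntry_ne_zero hrook (h2 ▸ he)]
    exact Nat.lt_succ_self _
  · exact fun i _ j _ hij => Fin.ext (congrArg Prod.snd hij)
  · rintro ⟨i, j⟩ hx
    obtain ⟨_, h1, h2⟩ := Finset.mem_filter.1 hx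
    dsimp only at h1 h2
    obtain ⟨rfl, hj⟩ := entry_eq hrook (h2 ▸ he : Γ.entry i j ≠ 0)
    exact ⟨⟨j, hj⟩, Finset.mem_filter.2 ⟨Finset.mem_univ _, h1, h2⟩, rfl⟩

/-- The lattice condition is the counting hypothesis of `exists_injOn_le`. The matched column has a
different entry, so it lies strictly to the right and is shorter. -/
theorem exists_isMatching (hrook : IsRookStrip β γ) (Γ : LRTableau β γ) :
    ∃ π, IsMatching (fun j : Fin (β.rowLen 0) => Γ.colEntry j) (fun j => β.colLen j)
      Set.univ π := by
  have key : ∀ e, ∃ f : Fin (β.rowLen 0) → Fin (β.rowLen 0), 1 ≤ e →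
      Set.InjOn f {j | Γ.colEntry j = e + 1} ∧
      ∀ j : Fin (β.rowLen 0), Γ.colEntry j = e + 1 → Γ.colEntry (f j) = e ∧ j ≤ f j := by
    intro e
    by_cases he : 1 ≤ e
    swap
    · exact ⟨id, fun h => absurd h he⟩
    obtain ⟨f, hf, hf'⟩ := exists_injOn_le
      (Finset.univ.filter fun j : Fin (β.rowLen 0) => Γ.colEntry j = e)
      (Finset.univ.filter fun j : Fin (β.rowLen 0) => Γ.colEntry j = e + 1) <| by
        intro c
        have := Γ.lattice c e he
        rw [card_filter_entry hrook _ (by omega), card_filter_entry hrook _ (by omega)] at this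
        simpa only [Finset.filter_filter, and_comm, Fin.le_def] using this
    simp only [Finset.coe_filter, Finset.mem_filter, Finset.mem_univ, true_and] at hf hf'
    exact ⟨f, fun _ => ⟨hf, hf'⟩⟩
  choose f hf using key
  have hpred : ∀ j : Fin (β.rowLen 0), 2 ≤ Γ.colEntry j →
      Γ.colEntry (f (Γ.colEntry j - 1) j) = Γ.colEntry j - 1 ∧ j ≤ f (Γ.colEntry j - 1) j :=
    fun j hj => (hf (Γ.colEntry j - 1) (by omega)).2 j (by omega)
  refine ⟨fun j => f (Γ.colEntry j - 1) j, fun _ _ _ => trivial, fun j _ hj => ?_,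
    fun j _ hj => ?_, fun i _ j _ hi hij he => ?_⟩
  · have := (hpred j hj).1
    omega
  · obtain ⟨h1, h2⟩ := hpred j hj
    refine colLen_lt_colLen (Γ := Γ) hrook (lt_of_le_of_ne h2 fun h => ?_) (by omega) (by omega)
    rw [← h] at h1
    omega
  · rw [← hij] at he
    exact (hf (Γ.colEntry i - 1) (by omega)).1 (by simp only [Set.mem_ofPred_eq]; omega)
      (by simp only [Set.mem_ofPred_eq]; omega) he

theorem mem_stage {e i j : ℕ} : (i, j) ∈ Γ.stage e ↔ (i, j) ∈ β ∧ Γ.entry i j ≤ e := by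
  rw [← YoungDiagram.mem_cells, stage, Finset.mem_filter, YoungDiagram.mem_cells]

theorem stage_zero : Γ.stage 0 = γ := by
  ext ⟨i, j⟩
  rw [YoungDiagram.mem_cells, YoungDiagram.mem_cells, mem_stage]
  refine ⟨fun ⟨h1, h2⟩ => ?_, fun h => ⟨Γ.le h, (Γ.zero i j (Or.inr h)).le⟩⟩
  by_contra hn
  have := Γ.pos i j h1 hn
  omega

theorem colLen_stage (hrook : IsRookStrip β γ) (e j : ℕ) :
    (Γ.stage e).colLen j = if e < Γ.colEntry j then β.colLen j - 1 else β.colLen j := by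
  refine eq_of_forall_lt_iff fun i => ?_
  rw [← YoungDiagram.mem_iff_lt_colLen, mem_stage, YoungDiagram.mem_iff_lt_colLen]
  by_cases h0 : Γ.entry i j = 0
  · have hne : Γ.colEntry j ≠ 0 → i ≠ γ.colLen j := by
      rintro h rfl
      exact h h0
    split_ifs with h
    · have := colLen_of_colEntry_ne_zero hrook (by omega : Γ.colEntry j ≠ 0)
      have := hne (by omega)
      omega
    · omega
  · obtain ⟨rfl, -⟩ := entry_eq hrook h0
    have h1 := colLen_of_colEntry_ne_zero hrook h0
    change _ ∧ Γ.colEntry j ≤ e ↔ _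
    split_ifs with h <;> omega

end LRTableau

/-- In `N_α` one may add columns of length `0`. -/
theorem nonempty_equiv_N (k : Type u) [Field k] (μ : YoungDiagram) {n : ℕ} (hn : μ.rowLen 0 ≤ n) :
    Nonempty (((j : Fin n) → Trunc k (μ.colLen j)) ≃ₗ[k[X]] N k μ) := by
  let φ : ((j : Fin n) → Trunc k (μ.colLen j)) →ₗ[k[X]] N k μ :=
    LinearMap.pi fun j => LinearMap.proj (Fin.castLE hn j)
  have hsub : ∀ (j : Fin n) (x : Trunc k (μ.colLen j)), μ.rowLen 0 ≤ j → x = 0 := by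
    intro j x hj
    obtain ⟨f, rfl⟩ := Trunc.mk_surjective _ x
    have h0 : μ.colLen j = 0 := by
      by_contra h
      have h1 := YoungDiagram.mem_iff_lt_rowLen.1
        (YoungDiagram.mem_iff_lt_colLen.2 (Nat.pos_of_ne_zero h))
      omega
    rw [Trunc.mk_eq_zero, h0, pow_zero]
    exact one_dvd f
  refine ⟨LinearEquiv.ofBijective φ ⟨?_, fun z => ?_⟩⟩
  · rw [injective_iff_map_eq_zero]
    intro y hy
    funext j
    by_cases hj : (j : ℕ) < μ.rowLen 0
    · exact congrFun hy ⟨j, hj⟩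
    · exact hsub j _ (not_lt.1 hj)
  · refine ⟨fun j => if hj : (j : ℕ) < μ.rowLen 0 then z ⟨j, hj⟩ else 0, funext fun j => ?_⟩
    exact dif_pos j.2

theorem rowLen_mono {μ ν : YoungDiagram} (h : μ ≤ ν) (i : ℕ) : μ.rowLen i ≤ ν.rowLen i := by
  by_contra hlt
  have := YoungDiagram.mem_iff_lt_rowLen.1
    (h (YoungDiagram.mem_iff_lt_rowLen.2 (not_le.1 hlt)))
  exact lt_irrefl _ this

/-! ### Realizing tableaux by string systems -/

section Realization

variable {k : Type u} [Field k] {β γ : YoungDiagram} {Γ : LRTableau β γ} {K : Type}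
  {σ : StringSystem (Fin (β.rowLen 0)) K fun j => β.colLen j}

theorem hasTableau_truncEmb (hrook : IsRookStrip β γ)
    (ht : ∀ c j, σ.place c j ≤ Γ.colEntry j)
    (ht' : ∀ j : Fin (β.rowLen 0), Γ.colEntry j ≠ 0 → ∃ c, σ.place c j = Γ.colEntry j) :
    (truncEmb _ (σ.sub k)).HasTableau Γ := by
  intro e
  obtain ⟨φ⟩ := σ.nonempty_quotient_equiv (k := k) (t := fun j => Γ.colEntry j) ht ht'
    fun j => LRTableau.colLen_stage hrook e j
  obtain ⟨ψ⟩ := nonempty_equiv_N k (Γ.stage e)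
    (rowLen_mono (fun x hx => (LRTableau.mem_stage.1 hx).1) 0)
  exact ⟨φ.trans ψ⟩

theorem hasType_truncEmb {A : Submodule k[X] ((j : Fin (β.rowLen 0)) → Trunc k (β.colLen j))}
    (h : (truncEmb _ A).HasTableau Γ) : (truncEmb _ A).HasType β γ := by
  refine ⟨⟨LinearEquiv.refl _ _⟩, ?_⟩
  have h0 := h 0
  have hA : (truncEmb _ A).powA 0 = A := by
    ext y
    simp [Emb.powA]
  rwa [LRTableau.stage_zero, hA] at h0

end Realization

theorem LRTableau.IncreasesEntry.extLE (k : Type u) [Field k] {β γ : YoungDiagram}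
    (hrook : IsRookStrip β γ) {Δ Γ : LRTableau β γ} (h : Δ.IncreasesEntry Γ) :
    LRTableau.ExtLE k Δ Γ := by
  obtain ⟨i, j, hβ, hγ, hlt, hother⟩ := h
  have hpos := Γ.pos i j hβ hγ
  obtain ⟨rfl, hj⟩ := LRTableau.entry_eq hrook (by omega : Γ.entry i j ≠ 0)
  set m : Fin (β.rowLen 0) := ⟨j, hj⟩
  obtain ⟨π, hπ⟩ := LRTableau.exists_isMatching hrook Γ
  obtain ⟨π', hπ'⟩ := LRTableau.exists_isMatching hrook Δ
  have hΔΓ : ∀ l : Fin (β.rowLen 0), l ≠ m → Δ.colEntry l = Γ.colEntry l := fun l hl =>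
    hother _ _ fun he => hl (Fin.ext (congrArg Prod.snd he))
  have hb : ∀ l : Fin (β.rowLen 0), 1 ≤ Γ.colEntry l → 1 ≤ β.colLen l := fun l hl => by
    rw [LRTableau.colLen_of_colEntry_ne_zero hrook (by omega : Γ.colEntry l ≠ 0)]
    omega
  obtain ⟨σ, hσ, S, T, hST, hS, hT⟩ := exists_strings (m := m) hπ hπ' hb hΔΓ hpos hlt
  have hwΔ : σ.Attachable fun c => if c = S then Γ.colEntry j else
      if c = T then Δ.colEntry j else 0 := by
    refine σ.attachable_of_isFree fun c hc => ?_
    split_ifs at hc ⊢ with h1 h2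
    · exact h1 ▸ hS
    · exact h2 ▸ hT
    · exact absurd rfl hc
  have hwΓ : σ.Attachable fun c => if c = S then Γ.colEntry j else 0 := by
    refine σ.attachable_of_isFree fun c hc => ?_
    split_ifs at hc ⊢ with h1
    · exact h1 ▸ hS
    · exact absurd rfl hc
  -- Column `m` has two places here; the larger one, in `T`, is the entry of `Δ`.
  have hΔ : (truncEmb _ ((σ.attach (hb m hpos) _ hwΔ).sub k)).HasTableau Δ := by
    refine hasTableau_truncEmb hrook (fun c l => ?_) fun l _ => ?_
    · change (if l = m then _ else if σ.str l = c then σ.place l else 0) ≤ _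
      split_ifs with h1 h2 h3 h4
      · exact h1 ▸ hlt.le
      · exact h1 ▸ le_rfl
      · exact Nat.zero_le _
      · rw [hσ, hΔΓ l h1]
      · exact Nat.zero_le _
    · by_cases h1 : l = m
      · refine ⟨T, (if_pos h1).trans ?_⟩
        rw [if_neg hST.symm, if_pos rfl, h1]
      · refine ⟨σ.str l, (if_neg h1).trans ?_⟩
        rw [if_pos rfl, hσ, hΔΓ l h1]
  have hΓ : (truncEmb _ ((σ.attach (hb m hpos) _ hwΓ).sub k)).HasTableau Γ := by
    refine hasTableau_truncEmb hrook (fun c l => ?_) fun l _ => ?_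
    · change (if l = m then _ else if σ.str l = c then σ.place l else 0) ≤ _
      split_ifs with h1 h2 h3
      · exact h1 ▸ le_rfl
      · exact Nat.zero_le _
      · rw [hσ]
      · exact Nat.zero_le _
    · by_cases h1 : l = m
      · refine ⟨S, (if_pos h1).trans ?_⟩
        rw [if_pos rfl, h1]
      · refine ⟨σ.str l, (if_neg h1).trans ?_⟩
        rw [if_pos rfl, hσ]
  refine ⟨1, fun i => if i = 0 then Δ else Γ, rfl, rfl, fun i hi => ?_⟩
  obtain rfl : i = 0 := by omega
  exact ⟨_, _, hasType_truncEmb hΔ, hasType_truncEmb hΓ, hΔ, hΓ,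
    σ.extLE_attach (hb m hpos) hST hpos hlt hwΔ hwΓ⟩

end RookStrip

theorem mainTheorem5 (k : Type*) [Field k] (β γ : YoungDiagram)
    (hrook : RookStrip.IsRookStrip β γ) (Δ Γ : RookStrip.LRTableau β γ)
    (h : Δ.IncreasesEntry Γ) : RookStrip.LRTableau.ExtLE k Δ Γ :=
  h.extLE k hrook
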